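/- For all natural numbers $m, d, r$ there is a natural number $N$ (depending only on $m$, $d$ and $r$) such that the following holds for every field $K$. Let $f_1, \dots, f_r \in K[X_1, \dots, X_m]$ be polynomials of total degree at most $d$ such that the ideal $I = (f_1, \dots, f_r)$ of $K[X_1, \dots, X_m]$ is maximal. Then the $K$-vector space $K[X_1, \dots, X_m]/I$ is finite-dimensional and $$\dim_K K[X_1, \dots, X_m]/I \le N.$$ -/

import Mathlib

universe u

/-!
The residue field `L = K[X₁, …, Xₘ] / I` is generated over `K` by the classes `xᵢ` of the variables,
so it is enough to bound the degree of each `xᵢ` over `K`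
(`finrank_le_pow_of_aeval_X_mem`; the degree of `L` is at most the product of these degrees).

The polynomials of bounded degree are specializations `A → K` of generic polynomials, which generate
an ideal `J` of `A[X₁, …, Xₘ]`, for a polynomial ring `A` over `ℤ` independent of `K`
(`exists_map_genericPolynomial_eq`). Put `B = A[X₁, …, Xₘ] / J` and consider `π : A[T] → B`,
`T ↦ Xᵢ`. By Chevalley's theorem the image of `Spec B → Spec A[T]` is a finite union of sets
`V(g₁, …, gₙ) \ V(f)`. The largest degree of the `gⱼ` that occur bounds the degree of `xᵢ` for all
fields `K` at once (`exists_natDegree_le_aeval_X_mem`):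

* The kernel `p₀` of `A[T] → L`, `T ↦ xᵢ`, lies in the image, hence in one of the sets
  `V(g₁, …, gₙ) \ V(f)`. So every `gⱼ` vanishes at `xᵢ`, and `f` does not vanish in `K[T]`.
* The kernel `p₁` of `A[T] → K(T)` does not lie in the image: otherwise `B` and `K(T)` map to a
  common nontrivial ring compatibly with `A[T]` (`exists_common_extension`), and so does
  `L = K ⊗ B`, with `xᵢ ↦ T`. But `xᵢ` is algebraic over `K` by Zariski's lemma, while `T` is not.
* As `p₁` is outside `V(g₁, …, gₙ) \ V(f)` but also outside `V(f)`, some `gⱼ` has nonzero image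
  in `K[T]`. That image is a nonzero polynomial of bounded degree with root `xᵢ`.
-/

universe v w

open TensorProduct in
/-- If the kernel of a homomorphism `θ` from `R` to a field is the contraction of a prime `q` of
`S`, then the field and `S` both map to a nontrivial ring, compatibly with `R`. The ring is the
tensor product of the field with the residue field of `q` over that of the contraction. -/
theorem exists_common_extension {R : Type*} {Ω : Type v} {S : Type w}
    [CommRing R] [Field Ω] [CommRing S]
    (θ : R →+* Ω) (π : R →+* S) (q : Ideal S) [q.IsPrime] (h : RingHom.ker θ = q.comap π) :
    ∃ (M : Type (max v w)) (_ : CommRing M) (_ : Nontrivial M) (α : Ω →+* M) (β : S →+* M),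
      α.comp θ = β.comp π := by
  let p := q.comap π
  let a : p.ResidueField →+* Ω := Ideal.ResidueField.lift p θ h.ge (by
    intro x hx
    have : θ x ≠ 0 := fun h0 => hx (h.le h0)
    exact this.isUnit)
  let b : p.ResidueField →+* q.ResidueField := Ideal.ResidueField.map p q π rfl
  algebraize [a, b]
  refine ⟨Ω ⊗[p.ResidueField] q.ResidueField, inferInstance, inferInstance,
    Algebra.TensorProduct.includeLeftRingHom,
    (Algebra.TensorProduct.includeRight (R := p.ResidueField) (A := Ω)).toRingHom.comp
      (algebraMap S q.ResidueField), ?_⟩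
  ext x
  have h1 : θ x = algebraMap p.ResidueField Ω (algebraMap R _ x) := by
    simp only [RingHom.algebraMap_toAlgebra, a]
    exact (Ideal.ResidueField.lift_algebraMap ..).symm
  have h2 : algebraMap S q.ResidueField (π x)
      = algebraMap p.ResidueField q.ResidueField (algebraMap R _ x) := by
    simp [RingHom.algebraMap_toAlgebra, b, Ideal.ResidueField.map_algebraMap]
  simp [h1, h2]

open Polynomial PrimeSpectrum in
/-- Among all specializations of a finitely generated ideal `J` over `A` to a maximal ideal over a
field, the degree of the class of `X i` over the field is bounded. The bound is read off from a
presentation of the image of `Spec (A[X] / J) → Spec A[T]` as a constructible set. -/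
theorem exists_natDegree_le_aeval_X_mem {A σ : Type*} [CommRing A] [Finite σ]
    (J : Ideal (MvPolynomial σ A)) (hJ : J.FG) (i : σ) :
    ∃ N : ℕ, ∀ (K : Type v) [Field K] (φ : A →+* K),
      (J.map (MvPolynomial.map φ)).IsMaximal →
      ∃ q : K[X], q ≠ 0 ∧ q.natDegree ≤ N ∧
        aeval (MvPolynomial.X i) q ∈ J.map (MvPolynomial.map φ) := by
  let B := MvPolynomial σ A ⧸ J
  let π : A[X] →+* B := eval₂RingHom (algebraMap A B) (Ideal.Quotient.mk J (MvPolynomial.X i))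
  have hπ : π.FinitePresentation := by
    refine RingHom.FinitePresentation.of_comp_finiteType C (g := π) ?_ ?_
    · have : π.comp C = algebraMap A B := by ext; simp [π]
      rw [this, RingHom.finitePresentation_algebraMap]
      exact Algebra.FinitePresentation.quotient hJ
    · exact (RingHom.finiteType_algebraMap (A := A) (B := A[X])).mpr inferInstance
  obtain ⟨S, hS⟩ := exists_constructibleSetData_iff.mpr (isConstructible_range_comap hπ)
  refine ⟨S.sup fun c ↦ Finset.univ.sup fun j ↦ (c.g j).natDegree, fun K _ φ hI ↦ ?_⟩
  set I := J.map (MvPolynomial.map (σ := σ) φ) with hIdef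
  let := Ideal.Quotient.field I
  let x : MvPolynomial σ K ⧸ I := Ideal.Quotient.mk I (MvPolynomial.X i)
  let ψ : B →+* MvPolynomial σ K ⧸ I :=
    Ideal.quotientMap I (MvPolynomial.map φ) Ideal.le_comap_map
  let ev : K[X] →+* MvPolynomial σ K ⧸ I := (aeval (R := K) x).toRingHom
  let χ : A[X] →+* K[X] := mapRingHom φ
  have hev : ev.comp χ = ψ.comp π := by
    ext a
    · have : ψ (algebraMap A B a) = algebraMap K _ (φ a) := by
        change Ideal.quotientMap I (MvPolynomial.map φ) Ideal.le_comap_map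
          (Ideal.Quotient.mk J (MvPolynomial.C a)) = Ideal.Quotient.mk I (MvPolynomial.C (φ a))
        simp
      simp [ev, χ, π, this]
    · have : ψ (Ideal.Quotient.mk J (MvPolynomial.X i)) = x := by
        change Ideal.quotientMap I (MvPolynomial.map φ) Ideal.le_comap_map _ = _
        simp [x]
      simp [ev, χ, π, this]
  -- the kernel of `A[T] → L`
  let p₀ : PrimeSpectrum A[X] := comap (ev.comp χ) ⊥
  have hp₀ : p₀ ∈ Set.range (comap π) := ⟨comap ψ ⊥, by rw [← comap_comp_apply, ← hev]⟩
  -- the kernel of `A[T] → K(T)`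
  let θ : A[X] →+* RatFunc K := (algebraMap K[X] (RatFunc K)).comp χ
  let p₁ : PrimeSpectrum A[X] := comap θ ⊥
  have hp₁ : p₁ ∉ Set.range (comap π) := by
    rintro ⟨q, hq⟩
    obtain ⟨M, _, _, α, β, h⟩ := exists_common_extension θ π q.asIdeal
      (by rw [← comap_asIdeal, hq]; rfl)
    -- `δ` factors through `L` and sends `X i` to the image of the transcendental `T`.
    let δ : MvPolynomial σ K →+* M := MvPolynomial.eval₂Hom
      (α.comp (algebraMap K (RatFunc K))) fun s ↦ β (Ideal.Quotient.mk J (MvPolynomial.X s))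
    have hδ : δ.comp (MvPolynomial.map φ) = β.comp (Ideal.Quotient.mk J) := by
      ext a
      · have := RingHom.congr_fun h (C a)
        have hC : π (C a) = Ideal.Quotient.mk J (MvPolynomial.C a) := eval₂_C _ _
        simpa [θ, χ, δ, hC, RatFunc.algebraMap_C, RatFunc.algebraMap_eq_C] using this
      · simp [δ]
    have hIδ : I ≤ RingHom.ker δ := by
      rw [hIdef, Ideal.map_le_iff_le_comap]
      intro a ha
      have := RingHom.congr_fun hδ a
      simpa [Ideal.Quotient.eq_zero_iff_mem.mpr ha] using this
    have : Module.Finite K (MvPolynomial σ K ⧸ I) := finite_of_finite_type_of_isJacobsonRing _ _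
    obtain ⟨μ, hμ, hμx⟩ := (Algebra.IsIntegral.isIntegral (R := K) x).isAlgebraic
    have hμI : aeval (MvPolynomial.X i) μ ∈ I := by
      rw [← Ideal.Quotient.eq_zero_iff_mem, ← hμx]
      exact (aeval_algHom_apply (Ideal.Quotient.mkₐ K I) (MvPolynomial.X i) _).symm
    have hδα : δ.comp (aeval (R := K) (MvPolynomial.X i)).toRingHom =
        α.comp (algebraMap K[X] (RatFunc K)) := by
      ext a
      · simp [δ, RatFunc.algebraMap_C, RatFunc.algebraMap_eq_C]
      · have := RingHom.congr_fun h X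
        have hX : π X = Ideal.Quotient.mk J (MvPolynomial.X i) := eval₂_X _ _
        simpa [θ, χ, δ, hX] using this.symm
    have h0 := RingHom.congr_fun hδα μ
    have h1 : δ (aeval (MvPolynomial.X i) μ) = 0 := hIδ hμI
    have h2 : α (algebraMap K[X] (RatFunc K) μ) = 0 := h0.symm.trans h1
    rw [map_eq_zero_iff α α.injective, map_eq_zero_iff _ (RatFunc.algebraMap_injective K)] at h2
    exact hμ h2
  rw [← hS] at hp₀ hp₁
  simp only [ConstructibleSetData.toSet, Set.mem_iUnion, not_exists] at hp₀ hp₁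
  obtain ⟨c, hc, hmem, hf⟩ := hp₀
  have hnot := hp₁ c hc
  have hle : ∀ g, χ g = 0 → g ∈ p₀.asIdeal := by
    intro g hg
    simp [p₀, hg]
  have hmem' : ∀ j, ev (χ (c.g j)) = 0 := by
    intro j
    have := hmem (Set.mem_range_self j)
    simpa [p₀] using this
  have : ∃ j, χ (c.g j) ≠ 0 := by
    by_contra! hall
    refine hnot ⟨?_, ?_⟩
    · rintro _ ⟨j, rfl⟩
      simp [p₁, θ, hall]
    · intro h1
      refine hf ?_
      have : χ c.f = 0 := by simpa [p₁, θ] using h1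
      simpa using hle _ this
  obtain ⟨j, hj⟩ := this
  refine ⟨χ (c.g j), hj, ?_, ?_⟩
  · refine natDegree_map_le.trans ?_
    refine le_trans ?_ (Finset.le_sup (f := fun c : BasicConstructibleSetData A[X] ↦
      Finset.univ.sup fun j ↦ (c.g j).natDegree) hc)
    exact Finset.le_sup (f := fun j ↦ (c.g j).natDegree) (Finset.mem_univ j)
  · rw [← Ideal.Quotient.eq_zero_iff_mem, ← hmem' j]
    exact (aeval_algHom_apply (Ideal.Quotient.mkₐ K I) (MvPolynomial.X i) _).symm

open MvPolynomial in
theorem finrank_le_pow_of_aeval_X_mem {K : Type*} [Field K] {m : ℕ} (N : ℕ)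
    (I : Ideal (MvPolynomial (Fin m) K)) [I.IsMaximal]
    (h : ∀ i, ∃ q : Polynomial K, q ≠ 0 ∧ q.natDegree ≤ N ∧ Polynomial.aeval (X i) q ∈ I) :
    Module.Finite K (MvPolynomial (Fin m) K ⧸ I) ∧
      Module.finrank K (MvPolynomial (Fin m) K ⧸ I) ≤ N ^ m := by
  let := Ideal.Quotient.field I
  have hfin : Module.Finite K (MvPolynomial (Fin m) K ⧸ I) :=
    finite_of_finite_type_of_isJacobsonRing _ _
  refine ⟨hfin, ?_⟩
  let x : Fin m → MvPolynomial (Fin m) K ⧸ I := fun i ↦ Ideal.Quotient.mk I (X i)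
  have hx : ∀ i, Module.finrank K (IntermediateField.adjoin K {x i}) ≤ N := by
    intro i
    obtain ⟨q, hq, hqN, hqI⟩ := h i
    rw [IntermediateField.adjoin.finrank (IsIntegral.of_finite K _)]
    refine le_trans (Polynomial.natDegree_le_of_dvd (minpoly.dvd _ _ ?_) hq) hqN
    rw [← Ideal.Quotient.eq_zero_iff_mem] at hqI
    rw [← hqI]
    exact Polynomial.aeval_algHom_apply (Ideal.Quotient.mkₐ K I) (X i) _
  have key : ∀ s : Finset (Fin m), Module.finrank K
      (s.sup fun i ↦ IntermediateField.adjoin K {x i} :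
        IntermediateField K (MvPolynomial (Fin m) K ⧸ I)) ≤ N ^ s.card := by
    intro s
    induction s using Finset.induction_on with
    | empty => rw [Finset.sup_empty, IntermediateField.finrank_bot, Finset.card_empty, pow_zero]
    | insert a s ha ih =>
      rw [Finset.sup_insert, Finset.card_insert_of_notMem ha, pow_succ']
      exact (IntermediateField.finrank_sup_le _ _).trans (Nat.mul_le_mul (hx a) ih)
  have htop : (Finset.univ.sup fun i ↦ IntermediateField.adjoin K {x i} :
      IntermediateField K (MvPolynomial (Fin m) K ⧸ I)) = ⊤ := by
    refine eq_top_iff.mpr fun y _ ↦ ?_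
    obtain ⟨y, rfl⟩ := Ideal.Quotient.mk_surjective y
    induction y using MvPolynomial.induction_on with
    | C a => exact IntermediateField.algebraMap_mem _ a
    | add p q hp hq => rw [map_add]; exact add_mem (hp trivial) (hq trivial)
    | mul_X p i hp =>
      rw [map_mul]
      refine mul_mem (hp trivial) ?_
      exact (Finset.le_sup (f := fun i ↦ IntermediateField.adjoin K {x i}) (Finset.mem_univ i))
        (IntermediateField.mem_adjoin_simple_self K (x i))
  have := key Finset.univ
  rw [htop, IntermediateField.finrank_top', Finset.card_univ, Fintype.card_fin] at this
  exact this

open MvPolynomial in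
/-- The polynomial in `m` variables, of degree at most `d` in each of them, whose coefficients are
independent indeterminates over `ℤ`; the indeterminates attached to distinct `i : ι` are distinct.
Bounding the degree in each variable separately makes the set of exponents `Fin m → Fin (d + 1)`. -/
noncomputable def genericPolynomial (m d : ℕ) {ι : Type*} (i : ι) :
    MvPolynomial (Fin m) (MvPolynomial (ι × (Fin m → Fin (d + 1))) ℤ) :=
  ∑ e : Fin m → Fin (d + 1),
    monomial (Finsupp.equivFunOnFinite.symm fun k ↦ (e k : ℕ)) (X (i, e))

open MvPolynomial in
theorem exists_map_genericPolynomial_eq {m d : ℕ} {ι K : Type*} [CommRing K]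
    (f : ι → MvPolynomial (Fin m) K) (hf : ∀ i, (f i).totalDegree ≤ d) :
    ∃ φ : MvPolynomial (ι × (Fin m → Fin (d + 1))) ℤ →+* K,
      ∀ i, map φ (genericPolynomial m d i) = f i := by
  refine ⟨eval₂Hom (Int.castRingHom K) fun c ↦
    coeff (Finsupp.equivFunOnFinite.symm fun k ↦ (c.2 k : ℕ)) (f c.1), fun i ↦ ?_⟩
  ext s
  simp only [genericPolynomial, map_sum, map_monomial, coeff_sum, coeff_monomial, coe_eval₂Hom,
    eval₂_X]
  by_cases hs : ∀ k, s k < d + 1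
  · rw [Finset.sum_eq_single fun k ↦ ⟨s k, hs k⟩]
    · have : (Finsupp.equivFunOnFinite.symm fun k ↦ s k) = s := by ext; simp
      simp [this]
    · intro e _ he
      rw [if_neg]
      rintro rfl
      exact he (by ext; simp)
    · simp
  · rw [Finset.sum_eq_zero]
    · by_contra hne
      have hmem : s ∈ (f i).support := mem_support_iff.mpr (Ne.symm hne)
      refine hs fun k ↦ Nat.lt_succ_of_le ?_
      exact (monomial_le_degreeOf k hmem).trans ((degreeOf_le_totalDegree _ _).trans (hf i))
    · intro e _
      rw [if_neg]
      rintro rfl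
      exact hs fun k ↦ (e k).isLt

theorem mainTheorem6 (m d r : ℕ) :
    ∃ N : ℕ, ∀ (K : Type u) [Field K] (f : Fin r → MvPolynomial (Fin m) K),
      (∀ i, (f i).totalDegree ≤ d) →
      (Ideal.span (Set.range f)).IsMaximal →
      Module.rank K (MvPolynomial (Fin m) K ⧸ Ideal.span (Set.range f)) ≤ (N : Cardinal.{u}) := by
  let J := Ideal.span (Set.range (genericPolynomial m d (ι := Fin r)))
  have hJ : J.FG := Submodule.fg_span (Set.finite_range _)
  choose N hN using fun i ↦ exists_natDegree_le_aeval_X_mem.{u} J hJ i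
  refine ⟨(Finset.univ.sup N) ^ m, fun K _ f hf hI ↦ ?_⟩
  obtain ⟨φ, hφ⟩ := exists_map_genericPolynomial_eq f hf
  have hJI : J.map (MvPolynomial.map φ) = Ideal.span (Set.range f) := by
    rw [Ideal.map_span, ← Set.range_comp]
    congr 2
    exact funext hφ
  obtain ⟨_, h⟩ := finrank_le_pow_of_aeval_X_mem (Finset.univ.sup N) (Ideal.span (Set.range f))
    fun i ↦ by
      obtain ⟨q, hq0, hqN, hq⟩ := hN i K φ (hJI ▸ hI)
      exact ⟨q, hq0, hqN.trans (Finset.le_sup (Finset.mem_univ i)), hJI ▸ hq⟩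
  rw [← Module.finrank_eq_rank]
  exact_mod_cast h
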